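/- Let $H$ be a separable complex Hilbert space and $A=qU$ with $q\in\mathbb C\setminus\{0\}$ and $U$ unitary on $H$, so that $A^*A=AA^*=r_AI$ with $r_A=|q|^2$. Let $\phi\in H$ be a cyclic vector of norm $1$, i.e. $\{P(A,A^*)\phi : P\in\mathbb C[X,Y]\}$ is dense in $H$. For $N\in\mathbb N$ let $H_N$, $H_N^-$, $H_N^+$ be the linear spans of the vectors $A^i(A^*)^j\phi$ with, respectively, $i,j\le N$; $i<N,\ j\le N$; $0<i\le N,\ j\le N$. Let $W_N^{\pm}$ be the orthogonal complement of $H_N^{\pm}$ in $H_N$, let $V_N:W_N^-\to W_N^+$ be any unitary operator, and let $A_N:H_N\to H_N$ be the linear operator that equals $A$ on $H_N^-$ and $\sqrt{r_A}\,V_N$ on $W_N^-$. Let $(u_N(n))_{n<D_N}$, $D_N=\dim H_N$, be any orthonormal basis of $H_N$ consisting of eigenvectors of $A_N$, with eigenvalues $\lambda_N(n)$, such that $\xi_N(n)=\langle u_N(n)|\phi\rangle$ is a non-negative real for all $n$ (with the inner product linear in its second argument). Let $M$ be a natural number with $M>\|A\|$ and $M>\sqrt{r_A}$, let $S=\{\lambda\in\mathbb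 C: |\mathrm{Re}\,\lambda|\le M,\ |\mathrm{Im}\,\lambda|\le M\}$ and let $S^-$ be the interior of $S$. Let $D$ be an ultrafilter on $\mathbb N$ with $\{N\ge 1 : \sqrt N\in\mathbb N,\ m\mid\sqrt N\}\in D$ for all $m\ge 1$. For $X\subseteq\mathbb C$ let $\mu_N(X)=\sum_{n<D_N,\ \lambda_N(n)\in X}\xi_N(n)^2$, and let $\mu^n(X)=\lim_D\mu_N(X)$ (ultralimit along $D$). A real $t\in[-M,M]$ is nice if for every $\delta>0$ there is $\varepsilon>0$ with $\mu^n(\{\lambda\in S:|\mathrm{Re}\,\lambda-t|<\varepsilon\})<\delta$ and $\mu^n(\{\lambda\in S:|\mathrm{Im}\,\lambda-t|<\varepsilon\})<\delta$. Let $NI$ be any countable dense subset of $[-M,M]$ that consists of nice reals and contains $-M$ and $M$, and let $Sq^*$ be the family of the sets $\{\lambda\in S: r_0<\mathrm{Re}\,\lambda<r_1,\ r_2<\mathrm{Im}\,\lambda<r_3\}$ with $r_0,r_1,r_2,r_3\in NI$. For $X\subseteq\mathbb C$ put $$\mu^*(X)=\inf\Big\{\sum_{i=0}^\infty\mu^n(X_i)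 : X_i\in Sq^*,\ X\cap S^-\subseteq\bigcup_i X_i\Big\},$$ and let $\mu$ be the restriction of the outer measure $\mu^*$ to its Carathéodory measurable sets. Let $\sigma(A)$ be the set of all $\lambda\in\mathbb C$ such that $A-\lambda I$ does not have a bounded inverse, and let $\sigma^*(A)$ be the set of all $\lambda\in S^-$ such that every open neighbourhood of $\lambda$ contained in $S^-$ has positive $\mu$-measure. Then $$\sigma(A)=\sigma^*(A).$$ Moreover $\sigma(A)$ and $S\setminus\sigma(A)$ are measurable, $\mu(\sigma(A))=1$ and $\mu(S\setminus\sigma(A))=0$. -/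

import Mathlib

open MeasureTheory Filter Topology
open scoped ENNReal

namespace UltraSpectral

noncomputable section

section Approximations

variable {H : Type*} [NormedAddCommGroup H] [InnerProductSpace ℂ H] [CompleteSpace H]

/-- The operator `P(A, A*)` of a polynomial `P ∈ ℂ[X, Y]`
(the variables `X`, `Y` are those with index `0`, `1`). -/
def polyOp (A : H →L[ℂ] H) (P : MvPolynomial (Fin 2) ℂ) : H →L[ℂ] H :=
  ∑ m ∈ P.support, P.coeff m • (A ^ m 0 * (ContinuousLinearMap.adjoint A) ^ m 1)

/-- `φ` is cyclic for `A`: the vectors `P(A, A*) φ`, `P ∈ ℂ[X, Y]`, are dense in `H`. -/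
def IsCyclicVector (A : H →L[ℂ] H) (φ : H) : Prop :=
  Dense (Set.range fun P : MvPolynomial (Fin 2) ℂ => polyOp A P φ)

/-- The vector `A^i (A*)^j φ`. -/
def monoVec (A : H →L[ℂ] H) (φ : H) (i j : ℕ) : H :=
  (A ^ i) (((ContinuousLinearMap.adjoint A) ^ j) φ)

/-- `H_N`, the span of the `A^i (A*)^j φ` with `i ≤ N`, `j ≤ N`. -/
def HN (A : H →L[ℂ] H) (φ : H) (N : ℕ) : Submodule ℂ H :=
  Submodule.span ℂ {x | ∃ i j : ℕ, i ≤ N ∧ j ≤ N ∧ x = monoVec A φ i j}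

/-- `H_N⁻`, the span of the `A^i (A*)^j φ` with `i < N`, `j ≤ N`. -/
def HNminus (A : H →L[ℂ] H) (φ : H) (N : ℕ) : Submodule ℂ H :=
  Submodule.span ℂ {x | ∃ i j : ℕ, i < N ∧ j ≤ N ∧ x = monoVec A φ i j}

/-- `H_N⁺`, the span of the `A^i (A*)^j φ` with `0 < i ≤ N`, `j ≤ N`. -/
def HNplus (A : H →L[ℂ] H) (φ : H) (N : ℕ) : Submodule ℂ H :=
  Submodule.span ℂ {x | ∃ i j : ℕ, 0 < i ∧ i ≤ N ∧ j ≤ N ∧ x = monoVec A φ i j}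

/-- `W⁻`, the orthogonal complement of `H_N⁻` in `H_N`. -/
def Wminus (A : H →L[ℂ] H) (φ : H) (N : ℕ) : Submodule ℂ H := HN A φ N ⊓ (HNminus A φ N)ᗮ

/-- `W⁺`, the orthogonal complement of `H_N⁺` in `H_N`. -/
def Wplus (A : H →L[ℂ] H) (φ : H) (N : ℕ) : Submodule ℂ H := HN A φ N ⊓ (HNplus A φ N)ᗮ

instance finiteDimensional_HN (A : H →L[ℂ] H) (φ : H) (N : ℕ) :
    FiniteDimensional ℂ (HN A φ N) := by
  refine FiniteDimensional.span_of_finite ℂ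
    ((((Set.finite_Iic N).prod (Set.finite_Iic N)).image
      (fun p : ℕ × ℕ => monoVec A φ p.1 p.2)).subset ?_)
  rintro x ⟨i, j, hi, hj, rfl⟩
  exact ⟨(i, j), ⟨hi, hj⟩, rfl⟩

theorem HNminus_le (A : H →L[ℂ] H) (φ : H) (N : ℕ) : HNminus A φ N ≤ HN A φ N :=
  Submodule.span_mono fun _ ⟨i, j, hi, hj, hx⟩ => ⟨i, j, hi.le, hj, hx⟩

instance finiteDimensional_HNminus (A : H →L[ℂ] H) (φ : H) (N : ℕ) :
    FiniteDimensional ℂ (HNminus A φ N) :=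
  Submodule.finiteDimensional_of_le (HNminus_le A φ N)

instance finiteDimensional_Wminus (A : H →L[ℂ] H) (φ : H) (N : ℕ) :
    FiniteDimensional ℂ (Wminus A φ N) :=
  Submodule.finiteDimensional_of_le (inf_le_left : Wminus A φ N ≤ HN A φ N)

theorem map_mem_HN (A : H →L[ℂ] H) (φ : H) (N : ℕ) {x : H} (hx : x ∈ HNminus A φ N) :
    A x ∈ HN A φ N := by
  have h : HNminus A φ N ≤ (HN A φ N).comap A.toLinearMap := by
    refine Submodule.span_le.2 ?_
    rintro y ⟨i, j, hi, hj, rfl⟩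
    refine Submodule.subset_span ⟨i + 1, j, hi, hj, ?_⟩
    simp [monoVec, pow_succ']
  exact h hx

/-- The operator `A_N` on `H_N = H_N⁻ ⊕ W⁻` attached to a unitary `V : W⁻ → W⁺`:
it is `A` on `H_N⁻` and `√r V` on `W⁻`. -/
def AN (A : H →L[ℂ] H) (φ : H) (r : ℝ) (N : ℕ) (V : Wminus A φ N ≃ₗᵢ[ℂ] Wplus A φ N) :
    HN A φ N →ₗ[ℂ] HN A φ N where
  toFun x :=
    ⟨A ((HNminus A φ N).orthogonalProjectionOnto (x : H) : H) +
      ((√r : ℝ) : ℂ) • (V ((Wminus A φ N).orthogonalProjectionOnto (x : H)) : H),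
      (HN A φ N).add_mem (map_mem_HN A φ N (Subtype.property _))
        ((HN A φ N).smul_mem _ (Subtype.property (V _)).1)⟩
  map_add' x y := by
    ext
    simp only [Submodule.coe_add, map_add, smul_add]
    abel
  map_smul' c x := by
    ext
    simp only [Submodule.coe_smul, map_smul, RingHom.id_apply, smul_add]
    rw [smul_comm]

end Approximations

/-- The measure `μ_N`: the sum of the `ξ(n)²` over all `n` with `λ(n) ∈ X`. -/
def muN {d : ℕ} (lam : Fin d → ℂ) (xi : Fin d → ℝ) (X : Set ℂ) : ℝ :=
  open Classical in ∑ n : Fin d, if lam n ∈ X then xi n ^ 2 else 0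

/-- The naive measure `μⁿ(X) = lim_D μ_N(X)`. The ultralimit exists because
the numbers `μ_N(X)` lie in `[0, 1]` for the families `lam`, `xi` of interest. -/
def muNaive (D : Ultrafilter ℕ) {d : ℕ → ℕ} (lam : ∀ N, Fin (d N) → ℂ)
    (xi : ∀ N, Fin (d N) → ℝ) (X : Set ℂ) : ℝ :=
  limUnder (D : Filter ℕ) fun N => muN (lam N) (xi N) X

/-- The closed square `S`. -/
def square (M : ℕ) : Set ℂ :=
  {z | -(M : ℝ) ≤ z.re ∧ z.re ≤ M ∧ -(M : ℝ) ≤ z.im ∧ z.im ≤ M}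

/-- The open square `S⁻`, the interior of `S`. -/
def openSquare (M : ℕ) : Set ℂ :=
  {z | -(M : ℝ) < z.re ∧ z.re < M ∧ -(M : ℝ) < z.im ∧ z.im < M}

/-- `t` is nice: the open strips in `S` of half-width `ε` around the lines `Re = t` and `Im = t`
have arbitrarily small naive measure. -/
def IsNice (D : Ultrafilter ℕ) {d : ℕ → ℕ} (lam : ∀ N, Fin (d N) → ℂ)
    (xi : ∀ N, Fin (d N) → ℝ) (M : ℕ) (t : ℝ) : Prop :=
  ∀ δ : ℝ, 0 < δ → ∃ ε : ℝ, 0 < ε ∧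
    muNaive D lam xi {z ∈ square M | |z.re - t| < ε} < δ ∧
    muNaive D lam xi {z ∈ square M | |z.im - t| < ε} < δ

/-- `Sq*`, the open rectangles in `S` with sides on the lines given by `NI`. -/
def SqStar (M : ℕ) (NI : Set ℝ) : Set (Set ℂ) :=
  {Y | ∃ r₀ ∈ NI, ∃ r₁ ∈ NI, ∃ r₂ ∈ NI, ∃ r₃ ∈ NI,
    Y = {z ∈ square M | r₀ < z.re ∧ z.re < r₁ ∧ r₂ < z.im ∧ z.im < r₃}}

/-- The outer measure `μ*` based on `μⁿ` on `Sq*`, with `μ*(X) = μ*(X ∩ Int S)` for all `X ⊆ ℂ`.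
The value is the infimum of `∑ μⁿ(X_i)` over all sequences in `Sq*` that cover
`X ∩ Int S`, see `muStar_apply`. -/
def muStar (D : Ultrafilter ℕ) {d : ℕ → ℕ} (lam : ∀ N, Fin (d N) → ℂ)
    (xi : ∀ N, Fin (d N) → ℝ) (M : ℕ) (NI : Set ℝ) : OuterMeasure ℂ :=
  OuterMeasure.restrict (openSquare M)
    (OuterMeasure.boundedBy fun X : Set ℂ =>
      ⨅ _ : X ∈ SqStar M NI, ENNReal.ofReal (muNaive D lam xi X))

theorem muStar_apply (D : Ultrafilter ℕ) {d : ℕ → ℕ} (lam : ∀ N, Fin (d N) → ℂ)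
    (xi : ∀ N, Fin (d N) → ℝ) (M : ℕ) (NI : Set ℝ) (hNI : NI.Nonempty) (X : Set ℂ) :
    muStar D lam xi M NI X =
      ⨅ (Y : ℕ → Set ℂ) (_ : ∀ i, Y i ∈ SqStar M NI) (_ : X ∩ openSquare M ⊆ ⋃ i, Y i),
        ∑' i, ENNReal.ofReal (muNaive D lam xi (Y i)) := by
  obtain ⟨t, ht⟩ := hNI
  have h0 : muNaive D lam xi ∅ = 0 := by
    have : (fun N => muN (lam N) (xi N) (∅ : Set ℂ)) = fun _ => (0 : ℝ) := by
      funext N; simp [muN]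
    rw [muNaive, this]
    exact tendsto_const_nhds.limUnder_eq
  have he : (∅ : Set ℂ) ∈ SqStar M NI := by
    refine ⟨t, ht, t, ht, t, ht, t, ht, ?_⟩
    ext z
    simp only [Set.mem_empty_iff_false, Set.mem_ofPred_eq, false_iff, not_and]
    intro _ h1 h2
    exact absurd h2 (not_lt.2 h1.le)
  rw [muStar, OuterMeasure.restrict_apply,
    OuterMeasure.boundedBy_eq_ofFunction (by simp [he, h0]), OuterMeasure.ofFunction_apply]
  refine le_antisymm ?_ ?_
  · refine le_iInf fun Y => le_iInf fun hY => le_iInf fun hc => ?_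
    refine (iInf₂_le Y hc).trans (le_of_eq ?_)
    simp [hY]
  · refine le_iInf fun Y => le_iInf fun hc => ?_
    by_cases hY : ∀ i, Y i ∈ SqStar M NI
    · refine (iInf_le _ Y).trans ((iInf_le _ hY).trans ((iInf_le _ hc).trans (le_of_eq ?_)))
      simp [hY]
    · push Not at hY
      obtain ⟨i, hi⟩ := hY
      have h : (⊤ : ℝ≥0∞) ≤ ∑' i, ⨅ _ : Y i ∈ SqStar M NI,
          ENNReal.ofReal (muNaive D lam xi (Y i)) :=
        le_trans (by simp [hi]) (ENNReal.le_tsum i)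
      exact le_top.trans h

/-- The spectral measure `μ`: the restriction of `μ*` to the σ-algebra of its
(Carathéodory) measurable sets. -/
def mu (D : Ultrafilter ℕ) {d : ℕ → ℕ} (lam : ∀ N, Fin (d N) → ℂ)
    (xi : ∀ N, Fin (d N) → ℝ) (M : ℕ) (NI : Set ℝ) :
    @Measure ℂ (muStar D lam xi M NI).caratheodory :=
  @OuterMeasure.toMeasure ℂ (muStar D lam xi M NI).caratheodory (muStar D lam xi M NI) le_rfl

/-- `σ*(A)`: the points of `S⁻` all of whose open neighbourhoods in `S⁻` have positive
`μ`-measure. -/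
def sigmaStar (D : Ultrafilter ℕ) {d : ℕ → ℕ} (lam : ∀ N, Fin (d N) → ℂ)
    (xi : ∀ N, Fin (d N) → ℝ) (M : ℕ) (NI : Set ℝ) : Set ℂ :=
  {z | z ∈ openSquare M ∧
    ∀ W : Set ℂ, IsOpen W → z ∈ W → W ⊆ openSquare M → 0 < mu D lam xi M NI W}

end

end UltraSpectral

/-! The measure `μ` is the spectral measure of `A` at `φ`. As `A` is normal, the continuous
functional calculus and Riesz–Markov give a Borel probability measure `m` on `σ(A)` with `∫ f dm =
⟨φ, f(A)φ⟩`; since `φ` is cyclic, the support of `m` is all of `σ(A)` (`exists_spectral_measure`).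

On the other side, `A_N^i φ = A^i φ` for `i ≤ N`, so `∑ ξ_N(n)² δ_{λ_N(n)}` has the same moments `∫
z^i z̄^j` as `m` for `i, j ≤ N` (`moment_discreteMeasure`). All these measures live on one disc, and
`D` contains every tail of `ℕ`, so Stone–Weierstrass yields weak convergence to `m` along `D`
(`tendsto_of_eventually_moments`).

Lines at nice levels are `m`-null, so the rectangles of `Sq*` are continuity sets and `μⁿ = m` on
them (`muNaive_eq_of_mem_SqStar`). Covering by these rectangles recovers `m` on all Borel sets
(`coverMeasure_eq`), whence `σ*(A)` is the support of `m`, that is, `σ(A)`. -/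

namespace UltraSpectral

/-! ### The spectral measure of a normal operator at a cyclic vector. -/

section SpectralMeasure

variable {H : Type*} [NormedAddCommGroup H] [InnerProductSpace ℂ H] [CompleteSpace H]

/-- A real continuous function, seen as a complex one. -/
def toComplexMap {X : Type*} [TopologicalSpace X] (f : C(X, ℝ)) : C(X, ℂ) :=
  ⟨fun x => (f x : ℂ), by fun_prop⟩

/-- The functional `f ↦ re ⟨φ, f(A) φ⟩` on the continuous functions on the spectrum of `A`. -/
noncomputable def spectralFunctional (A : H →L[ℂ] H) (hA : IsStarNormal A) (φ : H) :
    CompactlySupportedContinuousMap (spectrum ℂ A) ℝ →ₚ[ℝ] ℝ :=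
  PositiveLinearMap.mk₀
    { toFun := fun f => (inner ℂ φ (cfcHom (R := ℂ) hA (toComplexMap f.toContinuousMap) φ)).re
      map_add' := by
        intro f g
        have : toComplexMap (f + g).toContinuousMap =
            toComplexMap f.toContinuousMap + toComplexMap g.toContinuousMap := by
          ext x; simp [toComplexMap]
        rw [this]; simp
      map_smul' := by
        intro c f
        have : toComplexMap (c • f).toContinuousMap =
            (c : ℂ) • toComplexMap f.toContinuousMap := by
          ext x; simp [toComplexMap]
        rw [this, map_smul]; simp }
    (by
      intro f hf
      -- Positivity: with `f = g* g` the functional equals `‖g(A) φ‖²`.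
      let g : C(spectrum ℂ A, ℂ) := ⟨fun x => ((√(f x) : ℝ) : ℂ), by fun_prop⟩
      have hg : toComplexMap f.toContinuousMap = star g * g := by
        ext x
        have : 0 ≤ f x := hf x
        simp [toComplexMap, g, ← Complex.ofReal_mul, Real.mul_self_sqrt this]
      change 0 ≤ (inner ℂ φ (cfcHom (R := ℂ) hA (toComplexMap f.toContinuousMap) φ)).re
      rw [hg, map_mul, map_star, ContinuousLinearMap.star_eq_adjoint,
        mul_apply_eq_comp, ContinuousLinearMap.adjoint_inner_right]
      exact inner_self_nonneg (𝕜 := ℂ))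

/-- For real `f` the operator `f(A)` is self-adjoint, so taking the real part in
`spectralFunctional` loses nothing; the complex case follows by linearity. -/
theorem integral_spectralFunctional (A : H →L[ℂ] H) (hA : IsStarNormal A) (φ : H)
    (F : C(spectrum ℂ A, ℂ)) :
    ∫ x, F x ∂(RealRMK.rieszMeasure (spectralFunctional A hA φ)) =
      inner ℂ φ (cfcHom (R := ℂ) hA F φ) := by
  have key : ∀ f : C(spectrum ℂ A, ℝ),
      ((∫ x, f x ∂(RealRMK.rieszMeasure (spectralFunctional A hA φ)) : ℝ) : ℂ) =
        inner ℂ φ (cfcHom (R := ℂ) hA (toComplexMap f) φ) := by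
    intro f
    have h1 := RealRMK.integral_rieszMeasure (spectralFunctional A hA φ)
      (CompactlySupportedContinuousMap.continuousMapEquiv f)
    have h2 : (inner ℂ φ (cfcHom (R := ℂ) hA (toComplexMap f) φ)).im = 0 := by
      have hs : star (toComplexMap f) = toComplexMap f := by
        ext x; simp [toComplexMap]
      have : star (cfcHom (R := ℂ) hA (toComplexMap f)) = cfcHom (R := ℂ) hA (toComplexMap f) := by
        rw [← map_star, hs]
      rw [← Complex.conj_eq_iff_im, inner_conj_symm,
        ← ContinuousLinearMap.adjoint_inner_right, ← ContinuousLinearMap.star_eq_adjoint, this]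
    refine Complex.ext ?_ (by rw [h2]; simp)
    rw [Complex.ofReal_re]
    exact h1
  have hF : F = toComplexMap ⟨fun x => (F x).re, by fun_prop⟩ +
      Complex.I • toComplexMap ⟨fun x => (F x).im, by fun_prop⟩ := by
    ext x
    simp [toComplexMap, mul_comm Complex.I, Complex.re_add_im]
  have hint : Integrable (fun x => F x) (RealRMK.rieszMeasure (spectralFunctional A hA φ)) :=
    F.continuous.integrable_of_hasCompactSupport (HasCompactSupport.of_compactSpace _)
  rw [← integral_re_add_im hint]
  conv_rhs => rw [hF]
  have h1 := key ⟨fun x => (F x).re, by fun_prop⟩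
  have h2 := key ⟨fun x => (F x).im, by fun_prop⟩
  simp only [ContinuousMap.coe_mk] at h1 h2
  simp only [map_add, map_smul, add_apply, smul_apply,
    inner_add_right, inner_smul_right, ← h1, ← h2]
  simp [mul_comm]

theorem polyOp_comm {A B : H →L[ℂ] H} (h1 : Commute B A)
    (h2 : Commute B (ContinuousLinearMap.adjoint A)) (P : MvPolynomial (Fin 2) ℂ) :
    Commute B (polyOp A P) := by
  refine Commute.sum_right _ _ _ fun m _ => Commute.smul_right ?_ _
  exact (h1.pow_right _).mul_right (h2.pow_right _)

/-- A cyclic vector separates the commutant: `F(A)` commutes with every `P(A, A*)`, so it kills the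
dense set of vectors `P(A, A*) φ` once it kills `φ`. -/
theorem cfcHom_eq_zero_of_cyclic {A : H →L[ℂ] H} (hA : IsStarNormal A) {φ : H}
    (hc : IsCyclicVector A φ) (F : C(spectrum ℂ A, ℂ)) (h : cfcHom (R := ℂ) hA F φ = 0) :
    F = 0 := by
  have hid : cfcHom (R := ℂ) hA (.restrict (spectrum ℂ A) (.id ℂ)) = A := cfcHom_id hA
  have c1 : Commute (cfcHom (R := ℂ) hA F) A := by
    have := (Commute.all F (.restrict (spectrum ℂ A) (.id ℂ))).map (cfcHom (R := ℂ) hA)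
    rwa [hid] at this
  have c2 : Commute (cfcHom (R := ℂ) hA F) (ContinuousLinearMap.adjoint A) := by
    have := (Commute.all F (star (.restrict (spectrum ℂ A) (.id ℂ)))).map (cfcHom (R := ℂ) hA)
    rwa [map_star, hid] at this
  have h0 : cfcHom (R := ℂ) hA F = 0 := by
    refine ContinuousLinearMap.ext fun x => ?_
    refine congrFun (Continuous.ext_on hc (map_continuous _) continuous_const ?_
      : ⇑(cfcHom (R := ℂ) hA F) = fun _ => 0) x
    rintro _ ⟨P, rfl⟩
    have := (polyOp_comm c1 c2 P).eq
    have := congrArg (fun T : H →L[ℂ] H => T φ) this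
    simpa [h] using this
  exact cfcHom_injective hA (by rw [h0, map_zero])

theorem exists_spectral_measure (A : H →L[ℂ] H) (hA : IsStarNormal A) (φ : H) (hφ : ‖φ‖ = 1)
    (hc : IsCyclicVector A φ) :
    ∃ m : Measure ℂ, IsProbabilityMeasure m ∧
      (∀ i j : ℕ, ∫ z, z ^ i * (starRingEnd ℂ z) ^ j ∂m = inner ℂ ((A ^ j) φ) ((A ^ i) φ)) ∧
      m (spectrum ℂ A)ᶜ = 0 ∧
      ∀ z ∈ spectrum ℂ A, ∀ W : Set ℂ, IsOpen W → z ∈ W → 0 < m W := by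
  have hid : cfcHom (R := ℂ) hA (.restrict (spectrum ℂ A) (.id ℂ)) = A := cfcHom_id hA
  have hcl : MeasurableSet (spectrum ℂ A) := (spectrum.isClosed A).measurableSet
  set ν := RealRMK.rieszMeasure (spectralFunctional A hA φ) with hν
  have hmeas : Measurable ((↑) : spectrum ℂ A → ℂ) := measurable_subtype_coe
  have hemb : MeasurableEmbedding ((↑) : spectrum ℂ A → ℂ) := MeasurableEmbedding.subtype_coe hcl
  have hprob : IsProbabilityMeasure ν := by
    have h := integral_spectralFunctional A hA φ 1
    rw [map_one, one_apply_eq_self, inner_self_eq_norm_sq_to_K, hφ] at h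
    simp only [ContinuousMap.one_apply, integral_const] at h
    constructor
    have h2 : ν.real Set.univ = 1 := by
      have := congrArg Complex.re h
      simpa using this
    rw [measureReal_def] at h2
    exact (ENNReal.toReal_eq_one_iff _).1 h2
  refine ⟨ν.map (↑), Measure.isProbabilityMeasure_map hmeas.aemeasurable, ?_, ?_, ?_⟩
  · intro i j
    rw [hemb.integral_map]
    have h := integral_spectralFunctional A hA φ
      ((.restrict (spectrum ℂ A) (.id ℂ)) ^ i * (star (.restrict (spectrum ℂ A) (.id ℂ))) ^ j)
    rw [mul_comm, map_mul, map_pow, map_pow, map_star, hid, mul_apply_eq_comp,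
      ContinuousLinearMap.star_eq_adjoint, ← ContinuousLinearMap.star_eq_adjoint, ← star_pow,
      ContinuousLinearMap.star_eq_adjoint, ContinuousLinearMap.adjoint_inner_right] at h
    rw [← h]
    refine integral_congr_ae (.of_forall fun x => ?_)
    simp [mul_comm]
  · rw [Measure.map_apply hmeas hcl.compl]
    simp
  · intro z hz W hW hzW
    rw [Measure.map_apply hmeas hW.measurableSet, pos_iff_ne_zero]
    intro h0
    obtain ⟨ε, hε, hb⟩ := Metric.isOpen_iff.1 hW z hzW
    -- A bump at `z` supported in `W`. If `W` were null, then `‖g(A) φ‖² = ∫ |g|² = 0`, which forces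
    -- `g = 0` although `g z = ε`.
    let g : C(spectrum ℂ A, ℂ) := ⟨fun x => ((max 0 (ε - dist (x : ℂ) z) : ℝ) : ℂ), by fun_prop⟩
    have hz0 : g ⟨z, hz⟩ ≠ 0 := by simp [g, hε.le, hε.ne']
    refine hz0 ?_
    rw [cfcHom_eq_zero_of_cyclic hA hc g ?_]
    · rfl
    have h := integral_spectralFunctional A hA φ (star g * g)
    rw [map_mul, map_star, ContinuousLinearMap.star_eq_adjoint,
        mul_apply_eq_comp, ContinuousLinearMap.adjoint_inner_right] at h
    rw [← inner_self_eq_zero (𝕜 := ℂ), ← h]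
    refine integral_eq_zero_of_ae ?_
    have : ∀ᵐ x : spectrum ℂ A ∂ν, (x : ℂ) ∉ W := measure_eq_zero_iff_ae_notMem.1 h0
    filter_upwards [this] with x hx
    have : g x = 0 := by
      have hx' : ¬ dist (x : ℂ) z < ε := fun h => hx (hb h)
      simp [g, max_eq_left (sub_nonpos.2 (not_lt.1 hx'))]
    simp [this]

end SpectralMeasure

/-! ### Weak convergence from moments on a disc. -/

section WeakConvergence

/-- On a compact set the functions `z ^ i * conj z ^ j` span a dense subspace. -/
theorem mem_closure_span_monomials (s : Set ℂ) [CompactSpace s] (f : C(s, ℂ)) :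
    f ∈ closure (Submodule.span ℂ (Set.range fun p : ℕ × ℕ =>
      (.restrict s (.id ℂ) : C(s, ℂ)) ^ p.1 * (star (.restrict s (.id ℂ) : C(s, ℂ))) ^ p.2) :
      Set C(s, ℂ)) := by
  set S := Submodule.span ℂ (Set.range fun p : ℕ × ℕ =>
      (.restrict s (.id ℂ) : C(s, ℂ)) ^ p.1 * (star (.restrict s (.id ℂ) : C(s, ℂ))) ^ p.2)
  have hS : ∀ p : ℕ × ℕ, (.restrict s (.id ℂ) : C(s, ℂ)) ^ p.1 *
      (star (.restrict s (.id ℂ) : C(s, ℂ))) ^ p.2 ∈ S := fun p =>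
    Submodule.subset_span ⟨p, rfl⟩
  have hmul : S * S ≤ S := by
    rw [Submodule.span_mul_span, Submodule.span_le]
    rintro _ ⟨_, ⟨p, rfl⟩, _, ⟨q, rfl⟩, rfl⟩
    convert hS (p.1 + q.1, p.2 + q.2) using 1
    rw [SetLike.mem_coe]
    congr! 1
    simp only [pow_add]
    ring
  -- Stone–Weierstrass enters here; what remains is that the span of the monomials contains the star
  -- algebra generated by `z`.
  have h1 : f ∈ StarAlgebra.elemental ℂ (.restrict s (.id ℂ) : C(s, ℂ)) := by
    rw [ContinuousMap.elemental_id_eq_top]; trivial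
  rw [StarAlgebra.elemental, ← SetLike.mem_coe, StarSubalgebra.topologicalClosure_coe] at h1
  refine closure_mono ?_ h1
  intro g hg
  have hg' : g ∈ Algebra.adjoin ℂ ({(.restrict s (.id ℂ) : C(s, ℂ))} ∪
      star {(.restrict s (.id ℂ) : C(s, ℂ))}) := hg
  rw [SetLike.mem_coe]
  induction hg' using Algebra.adjoin_induction with
  | mem x hx =>
    rcases hx with hx | hx
    · rw [Set.mem_singleton_iff.1 hx]
      simpa using hS (1, 0)
    · rw [Set.star_singleton] at hx
      rw [Set.mem_singleton_iff.1 hx]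
      simpa using hS (0, 1)
  | algebraMap r =>
    rw [Algebra.algebraMap_eq_smul_one]
    exact S.smul_mem _ (by simpa using hS (0, 0))
  | add x y _ _ hx hy => exact S.add_mem (hx ‹_›) (hy ‹_›)
  | mul x y _ _ hx hy => exact hmul (Submodule.mul_mem_mul (hx ‹_›) (hy ‹_›))

theorem integrable_of_continuous_of_closedBall {m : Measure ℂ} [IsFiniteMeasure m] {R : ℝ}
    (h : m (Metric.closedBall 0 R)ᶜ = 0) {g : ℂ → ℂ} (hg : Continuous g) : Integrable g m := by
  have hr : m.restrict (Metric.closedBall 0 R) = m := by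
    rw [Measure.restrict_eq_self_of_ae_mem]
    exact h
  rw [← hr]
  exact hg.continuousOn.integrableOn_compact (isCompact_closedBall _ _)

theorem norm_integral_sub_le {m : Measure ℂ} [IsProbabilityMeasure m] {R ε : ℝ}
    (h : m (Metric.closedBall 0 R)ᶜ = 0) {f g : ℂ → ℂ} (hf : Continuous f) (hg : Continuous g)
    (hfg : ∀ z ∈ Metric.closedBall (0 : ℂ) R, ‖f z - g z‖ ≤ ε) :
    ‖∫ z, f z ∂m - ∫ z, g z ∂m‖ ≤ ε := by
  rw [← integral_sub (integrable_of_continuous_of_closedBall h hf)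
    (integrable_of_continuous_of_closedBall h hg)]
  have hae : ∀ᵐ z ∂m, ‖f z - g z‖ ≤ ε := by
    have : ∀ᵐ z ∂m, z ∈ Metric.closedBall (0 : ℂ) R := h
    filter_upwards [this] with z hz using hfg z hz
  simpa using norm_integral_le_of_norm_le_const hae

/-- Probability measures on a disc converge weakly if each moment is eventually right. -/
theorem tendsto_of_eventually_moments {ι : Type*} {L : Filter ι} {μ : ι → ProbabilityMeasure ℂ}
    {m : ProbabilityMeasure ℂ} {R : ℝ}
    (hμ : ∀ N, (μ N : Measure ℂ) (Metric.closedBall 0 R)ᶜ = 0)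
    (hm : (m : Measure ℂ) (Metric.closedBall 0 R)ᶜ = 0)
    (hmom : ∀ i j : ℕ, ∀ᶠ N in L, ∫ z, z ^ i * (starRingEnd ℂ z) ^ j ∂(μ N : Measure ℂ) =
      ∫ z, z ^ i * (starRingEnd ℂ z) ^ j ∂(m : Measure ℂ)) :
    Tendsto μ L (𝓝 m) := by
  have : CompactSpace (Metric.closedBall (0 : ℂ) R) :=
    isCompact_iff_compactSpace.1 (isCompact_closedBall _ _)
  rw [ProbabilityMeasure.tendsto_iff_forall_integral_rclike_tendsto ℂ]
  intro f
  -- A polynomial in `z`, `z̄` on the disc extends to `ℂ`. It involves finitely many moments, so its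
  -- integrals eventually agree exactly.
  have good : ∀ G ∈ Submodule.span ℂ (Set.range fun p : ℕ × ℕ =>
      (.restrict (Metric.closedBall (0 : ℂ) R) (.id ℂ) : C(Metric.closedBall (0 : ℂ) R, ℂ)) ^ p.1 *
      (star (.restrict (Metric.closedBall (0 : ℂ) R) (.id ℂ) :
        C(Metric.closedBall (0 : ℂ) R, ℂ))) ^ p.2),
      ∃ g : ℂ → ℂ, Continuous g ∧ (∀ z : Metric.closedBall (0 : ℂ) R, g z = G z) ∧
        ∀ᶠ N in L, ∫ z, g z ∂(μ N : Measure ℂ) = ∫ z, g z ∂(m : Measure ℂ) := by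
    intro G hG
    induction hG using Submodule.span_induction with
    | mem x hx =>
      obtain ⟨p, rfl⟩ := hx
      exact ⟨fun z => z ^ p.1 * (starRingEnd ℂ z) ^ p.2, by fun_prop, fun z => by simp, hmom _ _⟩
    | zero => exact ⟨fun _ => 0, by fun_prop, fun z => by simp, by simp⟩
    | add x y _ _ hx hy =>
      obtain ⟨g, hg, hgx, hgi⟩ := hx
      obtain ⟨g', hg', hgx', hgi'⟩ := hy
      refine ⟨fun z => g z + g' z, by fun_prop, fun z => by simp [hgx, hgx'], ?_⟩
      filter_upwards [hgi, hgi'] with N h1 h2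
      rw [integral_add (integrable_of_continuous_of_closedBall (hμ N) hg)
        (integrable_of_continuous_of_closedBall (hμ N) hg'),
        integral_add (integrable_of_continuous_of_closedBall hm hg)
        (integrable_of_continuous_of_closedBall hm hg'), h1, h2]
    | smul c x _ hx =>
      obtain ⟨g, hg, hgx, hgi⟩ := hx
      refine ⟨fun z => c * g z, by fun_prop, fun z => by simp [hgx], ?_⟩
      filter_upwards [hgi] with N h1
      rw [integral_const_mul, integral_const_mul, h1]
  rw [Metric.tendsto_nhds]
  intro ε hε
  obtain ⟨G, hG, hd⟩ := Metric.mem_closure_iff.1 (mem_closure_span_monomials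
    (Metric.closedBall (0 : ℂ) R) (f.toContinuousMap.restrict _)) (ε / 3) (by positivity)
  obtain ⟨g, hg, hgx, hgi⟩ := good G hG
  have hfg : ∀ z ∈ Metric.closedBall (0 : ℂ) R, ‖f z - g z‖ ≤ ε / 3 := by
    intro z hz
    rw [hgx ⟨z, hz⟩, ← dist_eq_norm]
    exact (ContinuousMap.dist_apply_le_dist (f := f.toContinuousMap.restrict _) (g := G)
      ⟨z, hz⟩).trans hd.le
  filter_upwards [hgi] with N hN
  have h1 := norm_integral_sub_le (hμ N) f.continuous hg hfg
  have h2 := norm_integral_sub_le hm f.continuous hg hfg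
  rw [dist_eq_norm]
  rw [hN] at h1
  rw [norm_sub_rev] at h2
  have := norm_add_le _ _ |>.trans (add_le_add h1 h2)
  rw [sub_add_sub_cancel] at this
  linarith

end WeakConvergence

/-! ### The measures `μ_N` as sums of point masses. -/

section Discrete

/-- The discrete measure `∑ ξ(n)² δ_{λ(n)}`. -/
noncomputable def discreteMeasure {d : ℕ} (lam : Fin d → ℂ) (xi : Fin d → ℝ) : Measure ℂ :=
  ∑ n, ENNReal.ofReal (xi n ^ 2) • Measure.dirac (lam n)

theorem discreteMeasure_apply {d : ℕ} (lam : Fin d → ℂ) (xi : Fin d → ℝ) {X : Set ℂ}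
    (hX : MeasurableSet X) : discreteMeasure lam xi X = ENNReal.ofReal (muN lam xi X) := by
  classical
  rw [discreteMeasure, muN, ENNReal.ofReal_sum_of_nonneg]
  · simp only [Measure.coe_finsetSum, Finset.sum_apply, Measure.smul_apply, smul_eq_mul,
      Measure.dirac_apply' _ hX, Set.indicator_apply]
    refine Finset.sum_congr rfl fun n _ => ?_
    split_ifs <;> simp
  · intro n _
    split_ifs <;> positivity

theorem muN_nonneg {d : ℕ} (lam : Fin d → ℂ) (xi : Fin d → ℝ) (X : Set ℂ) :
    0 ≤ muN lam xi X :=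
  Finset.sum_nonneg fun n _ => by split_ifs <;> positivity

theorem muN_mono {d : ℕ} (lam : Fin d → ℂ) (xi : Fin d → ℝ) {X Y : Set ℂ} (h : X ⊆ Y) :
    muN lam xi X ≤ muN lam xi Y := by
  refine Finset.sum_le_sum fun n _ => ?_
  by_cases h1 : lam n ∈ X
  · simp [h1, h h1]
  · rw [if_neg h1]
    split_ifs <;> positivity

theorem integral_discreteMeasure {d : ℕ} (lam : Fin d → ℂ) (xi : Fin d → ℝ) (f : ℂ → ℂ) :
    ∫ z, f z ∂(discreteMeasure lam xi) = ∑ n, ((xi n : ℂ) ^ 2) * f (lam n) := by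
  rw [discreteMeasure, integral_finsetSum_measure]
  · refine Finset.sum_congr rfl fun n _ => ?_
    rw [integral_smul_measure, integral_dirac, ENNReal.toReal_ofReal (by positivity)]
    simp
  · intro n _
    exact (integrable_dirac (by simp)).smul_measure ENNReal.ofReal_ne_top

end Discrete

/-! ### Moments and supports of the discrete measures. -/

section Moments

variable {H : Type*} [NormedAddCommGroup H] [InnerProductSpace ℂ H] [CompleteSpace H]

theorem cyclicVector_mem_HN (A : H →L[ℂ] H) (φ : H) (N : ℕ) : φ ∈ HN A φ N :=
  Submodule.subset_span ⟨0, 0, Nat.zero_le _, Nat.zero_le _, by simp [monoVec]⟩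

theorem coe_AN_apply (A : H →L[ℂ] H) (φ : H) (r : ℝ) (N : ℕ)
    (V : Wminus A φ N ≃ₗᵢ[ℂ] Wplus A φ N) (x : HN A φ N) :
    (AN A φ r N V x : H) = A ((HNminus A φ N).orthogonalProjectionOnto (x : H) : H) +
      ((√r : ℝ) : ℂ) • (V ((Wminus A φ N).orthogonalProjectionOnto (x : H)) : H) := rfl

/-- For `i < N` the vector `A^i φ` lies in `H_N⁻`, where `A_N` acts as `A`; the `W⁻` part is first
felt after step `N`. -/
theorem AN_pow_cyclicVector (A : H →L[ℂ] H) (φ : H) (r : ℝ) (N : ℕ)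
    (V : Wminus A φ N ≃ₗᵢ[ℂ] Wplus A φ N) {i : ℕ} (hi : i ≤ N) :
    (((AN A φ r N V) ^ i) ⟨φ, cyclicVector_mem_HN A φ N⟩ : H) = (A ^ i) φ := by
  induction i with
  | zero => simp
  | succ i ih =>
    have hm : (A ^ i) φ ∈ HNminus A φ N :=
      Submodule.subset_span ⟨i, 0, hi, Nat.zero_le _, by simp [monoVec]⟩
    have hw : (Wminus A φ N).orthogonalProjectionOnto ((A ^ i) φ) = 0 := by
      rw [Submodule.orthogonalProjectionOnto_eq_zero_iff]
      intro w hw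
      rw [← inner_conj_symm, hw.2 _ hm, map_zero]
    rw [pow_succ', Module.End.mul_apply, coe_AN_apply, ih (by omega), hw,
      Submodule.coe_orthogonalProjectionOnto_apply,
      Submodule.starProjection_eq_self_iff.2 hm]
    simp [pow_succ']

/-- A crude bound suffices: it only has to be uniform in `N`, so that one disc carries all the
discrete measures. -/
theorem norm_AN_le (A : H →L[ℂ] H) (φ : H) (r : ℝ) (N : ℕ)
    (V : Wminus A φ N ≃ₗᵢ[ℂ] Wplus A φ N) (x : HN A φ N) :
    ‖AN A φ r N V x‖ ≤ (‖A‖ + √r) * ‖x‖ := by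
  change ‖(AN A φ r N V x : H)‖ ≤ _
  rw [coe_AN_apply, add_mul]
  refine norm_add_le_of_le (A.le_opNorm_of_le ?_) ?_
  · exact Submodule.norm_orthogonalProjectionOnto_apply_le _ _
  · rw [norm_smul, Complex.norm_real, Real.norm_of_nonneg (Real.sqrt_nonneg _)]
    gcongr
    exact (V.norm_map _).trans_le (Submodule.norm_orthogonalProjectionOnto_apply_le _ _)

variable {A : H →L[ℂ] H} {φ : H} {r : ℝ} {N : ℕ} {V : Wminus A φ N ≃ₗᵢ[ℂ] Wplus A φ N}
  {d : ℕ} {u : OrthonormalBasis (Fin d) ℂ (HN A φ N)} {lam : Fin d → ℂ} {xi : Fin d → ℝ}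

theorem norm_eigenvalue_AN_le (hlam : ∀ n, AN A φ r N V (u n) = lam n • u n) (n : Fin d) :
    ‖lam n‖ ≤ ‖A‖ + √r := by
  have h := norm_AN_le A φ r N V (u n)
  rwa [hlam, norm_smul, u.norm_eq_one, mul_one, mul_one] at h

/-- In the eigenbasis `A_N^k φ` has coordinates `ξ(n) λ(n)^k`, so Parseval turns `⟨A_N^j φ, A_N^i
φ⟩` into the integral. Only powers of `A_N` occur; the conjugate comes from the first slot of the
inner product. -/
theorem moment_discreteMeasure (hlam : ∀ n, AN A φ r N V (u n) = lam n • u n)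
    (hxi : ∀ n, inner ℂ ((u n : HN A φ N) : H) φ = (xi n : ℂ)) {i j : ℕ} (hi : i ≤ N)
    (hj : j ≤ N) :
    ∫ z, z ^ i * (starRingEnd ℂ z) ^ j ∂(discreteMeasure lam xi) =
      inner ℂ ((A ^ j) φ) ((A ^ i) φ) := by
  set ψ : HN A φ N := ⟨φ, cyclicVector_mem_HN A φ N⟩ with hψ
  have hcoef : ∀ n, inner ℂ (u n) ψ = (xi n : ℂ) := hxi
  have hpow : ∀ (k : ℕ) n, ((AN A φ r N V) ^ k) (u n) = lam n ^ k • u n := by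
    intro k n
    induction k with
    | zero => simp
    | succ k ih => rw [pow_succ, Module.End.mul_apply, hlam, map_smul, ih, smul_smul, pow_succ']
  have hk : ∀ (k : ℕ) n, inner ℂ (u n) (((AN A φ r N V) ^ k) ψ) = (xi n : ℂ) * lam n ^ k := by
    intro k n
    conv_lhs => rw [← u.sum_repr' ψ]
    simp_rw [map_sum, map_smul, hpow, hcoef, smul_smul, inner_sum, inner_smul_right,
      u.inner_eq_ite]
    simp
  rw [← AN_pow_cyclicVector A φ r N V hi, ← AN_pow_cyclicVector A φ r N V hj,
    ← Submodule.coe_inner, ← u.sum_inner_mul_inner, integral_discreteMeasure]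
  refine Finset.sum_congr rfl fun n _ => ?_
  rw [hk, ← inner_conj_symm, hk]
  simp
  ring

theorem isProbabilityMeasure_discreteMeasure (hφ : ‖φ‖ = 1)
    (hxi : ∀ n, inner ℂ ((u n : HN A φ N) : H) φ = (xi n : ℂ)) :
    IsProbabilityMeasure (discreteMeasure lam xi) := by
  constructor
  rw [discreteMeasure_apply _ _ MeasurableSet.univ, ENNReal.ofReal_eq_one]
  set ψ : HN A φ N := ⟨φ, cyclicVector_mem_HN A φ N⟩ with hψ
  have h := u.sum_sq_norm_inner_right ψ
  have hcoef : ∀ n, inner ℂ (u n) ψ = (xi n : ℂ) := hxi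
  simp_rw [hcoef, Complex.norm_real, Real.norm_eq_abs, sq_abs] at h
  simp only [muN, Set.mem_univ, if_true]
  rw [h, show ‖ψ‖ = 1 from hφ, one_pow]

theorem discreteMeasure_compl_closedBall (hlam : ∀ n, AN A φ r N V (u n) = lam n • u n) :
    discreteMeasure lam xi (Metric.closedBall 0 (‖A‖ + √r))ᶜ = 0 := by
  rw [discreteMeasure_apply _ _ Metric.isClosed_closedBall.measurableSet.compl,
    ENNReal.ofReal_eq_zero]
  refine Finset.sum_nonpos fun n _ => ?_
  rw [if_neg]
  simpa using norm_eigenvalue_AN_le hlam n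

end Moments

/-! ### The naive measure agrees with `m` on the rectangles of `Sq*`. -/

section NaiveMeasure

variable {D : Ultrafilter ℕ} {d : ℕ → ℕ} {lam : ∀ N, Fin (d N) → ℂ} {xi : ∀ N, Fin (d N) → ℝ}
  {M : ℕ} {NI : Set ℝ} {μ : ℕ → ProbabilityMeasure ℂ} {m : ProbabilityMeasure ℂ}

theorem isOpen_openSquare (M : ℕ) : IsOpen (openSquare M) := by
  simp only [openSquare, Set.ofPred_and]
  refine (isOpen_lt ?_ ?_).inter ((isOpen_lt ?_ ?_).inter ((isOpen_lt ?_ ?_).inter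
    (isOpen_lt ?_ ?_))) <;> fun_prop

theorem openSquare_subset_square (M : ℕ) : openSquare M ⊆ square M :=
  fun _ h => ⟨h.1.le, h.2.1.le, h.2.2.1.le, h.2.2.2.le⟩

/-- `limUnder` is a true limit here, because an ultrafilter on the compact interval `[0, 1]`
converges. -/
theorem tendsto_muN (hμ : ∀ N, (μ N : Measure ℂ) = discreteMeasure (lam N) (xi N)) (X : Set ℂ) :
    Tendsto (fun N => muN (lam N) (xi N) X) D (𝓝 (muNaive D lam xi X)) := by
  refine tendsto_nhds_limUnder ?_
  have hb : ∀ N, muN (lam N) (xi N) X ∈ Set.Icc (0 : ℝ) 1 := by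
    intro N
    refine ⟨muN_nonneg _ _ _, (muN_mono _ _ (Set.subset_univ X)).trans ?_⟩
    rw [← ENNReal.ofReal_le_one, ← discreteMeasure_apply _ _ MeasurableSet.univ, ← hμ]
    exact prob_le_one
  obtain ⟨x, -, hx⟩ := isCompact_Icc.ultrafilter_le_nhds
    (D.map fun N => muN (lam N) (xi N) X)
    (by
      rw [Ultrafilter.coe_map, le_principal_iff]
      exact Filter.mem_map.2 (Filter.univ_mem' hb))
  exact ⟨x, hx⟩

/-- Portmanteau for the open strip around the line: its `m`-mass is at most the liminf of the
`μ_N`-masses, hence below `δ`. Niceness only speaks of the strip inside `S`, so it is cut with `S⁻`,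
whose complement is `m`-null. -/
theorem measure_level_eq_zero
    (hμ : ∀ N, (μ N : Measure ℂ) = discreteMeasure (lam N) (xi N))
    (hm : Tendsto μ D (𝓝 m)) (hS : (m : Measure ℂ) (openSquare M)ᶜ = 0)
    {p : ℂ → ℝ} (hp : Continuous p) {t : ℝ}
    (ht : ∀ δ : ℝ, 0 < δ → ∃ ε : ℝ, 0 < ε ∧
      muNaive D lam xi {z ∈ square M | |p z - t| < ε} < δ) :
    (m : Measure ℂ) {z | p z = t} = 0 := by
  refine le_antisymm (ENNReal.le_of_forall_pos_le_add fun δ hδ _ => ?_) bot_le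
  obtain ⟨ε, hε, hlt⟩ := ht δ (by exact_mod_cast hδ)
  set G : Set ℂ := openSquare M ∩ {z | |p z - t| < ε} with hG
  have hGo : IsOpen G := (isOpen_openSquare M).inter (isOpen_lt (by fun_prop) (by fun_prop))
  have h1 : (m : Measure ℂ) G ≤ ENNReal.ofReal (muNaive D lam xi {z ∈ square M | |p z - t| < ε}) := by
    refine (ProbabilityMeasure.le_liminf_measure_open_of_tendsto hm hGo).trans ?_
    rw [← (ENNReal.tendsto_ofReal (tendsto_muN (D := D) hμ _)).liminf_eq]
    refine liminf_le_liminf (.of_forall fun N => ?_)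
    rw [hμ, discreteMeasure_apply _ _ hGo.measurableSet]
    exact ENNReal.ofReal_le_ofReal (muN_mono _ _ fun z hz =>
      ⟨openSquare_subset_square M hz.1, hz.2⟩)
  calc (m : Measure ℂ) {z | p z = t} ≤ (m : Measure ℂ) (G ∪ (openSquare M)ᶜ) := by
        refine measure_mono fun z hz => ?_
        by_cases h : z ∈ openSquare M
        · exact Or.inl ⟨h, by simp [show p z = t from hz, hε]⟩
        · exact Or.inr h
    _ ≤ (m : Measure ℂ) G + (m : Measure ℂ) (openSquare M)ᶜ := measure_union_le _ _
    _ ≤ 0 + δ := by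
        rw [hS, add_zero, zero_add]
        exact h1.trans ((ENNReal.ofReal_le_ofReal hlt.le).trans (by simp))

/-- With sides in `[-M, M]` the condition `z ∈ S` is redundant, so the rectangles are open in `ℂ`.
-/
theorem eq_of_mem_SqStar (hsub : NI ⊆ Set.Icc (-(M : ℝ)) M) {Y : Set ℂ} (hY : Y ∈ SqStar M NI) :
    ∃ r₀ ∈ NI, ∃ r₁ ∈ NI, ∃ r₂ ∈ NI, ∃ r₃ ∈ NI,
      Y = {z | r₀ < z.re ∧ z.re < r₁ ∧ r₂ < z.im ∧ z.im < r₃} := by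
  obtain ⟨r₀, h₀, r₁, h₁, r₂, h₂, r₃, h₃, rfl⟩ := hY
  refine ⟨r₀, h₀, r₁, h₁, r₂, h₂, r₃, h₃, Set.ext fun z => ⟨fun h => h.2, fun h => ⟨?_, h⟩⟩⟩
  exact ⟨(hsub h₀).1.trans h.1.le, h.2.1.le.trans (hsub h₁).2, (hsub h₂).1.trans h.2.2.1.le,
    h.2.2.2.le.trans (hsub h₃).2⟩

theorem isOpen_of_mem_SqStar (hsub : NI ⊆ Set.Icc (-(M : ℝ)) M) {Y : Set ℂ}
    (hY : Y ∈ SqStar M NI) : IsOpen Y := by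
  obtain ⟨r₀, -, r₁, -, r₂, -, r₃, -, rfl⟩ := eq_of_mem_SqStar hsub hY
  simp only [Set.ofPred_and]
  refine (isOpen_lt ?_ ?_).inter ((isOpen_lt ?_ ?_).inter ((isOpen_lt ?_ ?_).inter
    (isOpen_lt ?_ ?_))) <;> fun_prop

/-- The frontier of `Y` lies on four nice lines, hence is `m`-null, and weak convergence passes to
the mass of `Y`. -/
theorem muNaive_eq_of_mem_SqStar
    (hμ : ∀ N, (μ N : Measure ℂ) = discreteMeasure (lam N) (xi N))
    (hm : Tendsto μ D (𝓝 m)) (hS : (m : Measure ℂ) (openSquare M)ᶜ = 0)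
    (hsub : NI ⊆ Set.Icc (-(M : ℝ)) M) (hnice : ∀ t ∈ NI, IsNice D lam xi M t)
    {Y : Set ℂ} (hY : Y ∈ SqStar M NI) :
    ENNReal.ofReal (muNaive D lam xi Y) = (m : Measure ℂ) Y := by
  have hYo := isOpen_of_mem_SqStar hsub hY
  have hre : ∀ t ∈ NI, (m : Measure ℂ) {z | z.re = t} = 0 := fun t ht =>
    measure_level_eq_zero hμ hm hS Complex.continuous_re fun δ hδ =>
      let ⟨ε, h1, h2, _⟩ := hnice t ht δ hδ
      ⟨ε, h1, h2⟩
  have him : ∀ t ∈ NI, (m : Measure ℂ) {z | z.im = t} = 0 := fun t ht =>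
    measure_level_eq_zero hμ hm hS Complex.continuous_im fun δ hδ =>
      let ⟨ε, h1, _, h2⟩ := hnice t ht δ hδ
      ⟨ε, h1, h2⟩
  have hfr : (m : Measure ℂ) (frontier Y) = 0 := by
    obtain ⟨r₀, h₀, r₁, h₁, r₂, h₂, r₃, h₃, hYe⟩ := eq_of_mem_SqStar hsub hY
    have hcl : closure Y ⊆ {z | r₀ ≤ z.re ∧ z.re ≤ r₁ ∧ r₂ ≤ z.im ∧ z.im ≤ r₃} := by
      refine closure_minimal ?_ ?_
      · rw [hYe]
        exact fun z h => ⟨h.1.le, h.2.1.le, h.2.2.1.le, h.2.2.2.le⟩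
      · simp only [Set.ofPred_and]
        refine (isClosed_le ?_ ?_).inter ((isClosed_le ?_ ?_).inter ((isClosed_le ?_ ?_).inter
          (isClosed_le ?_ ?_))) <;> fun_prop
    refine measure_mono_null (t := {z | z.re = r₀} ∪ {z | z.re = r₁} ∪ {z | z.im = r₂} ∪
      {z | z.im = r₃}) ?_ ?_
    · rw [hYo.frontier_eq]
      rintro z ⟨hz, hzY⟩
      obtain ⟨a, b, c, e⟩ := hcl hz
      by_contra hcon
      simp only [Set.mem_union, Set.mem_ofPred_eq, not_or] at hcon
      obtain ⟨⟨⟨h1, h2⟩, h3⟩, h4⟩ := hcon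
      refine hzY ?_
      rw [hYe]
      exact ⟨lt_of_le_of_ne a (Ne.symm h1), lt_of_le_of_ne b h2, lt_of_le_of_ne c (Ne.symm h3),
        lt_of_le_of_ne e h4⟩
    · exact measure_union_null (measure_union_null (measure_union_null (hre _ h₀) (hre _ h₁))
        (him _ h₂)) (him _ h₃)
  have h1 := ProbabilityMeasure.tendsto_measure_of_null_frontier_of_tendsto' hm hfr
  refine tendsto_nhds_unique (ENNReal.tendsto_ofReal (tendsto_muN (D := D) hμ Y)) ?_
  refine h1.congr fun N => ?_
  rw [hμ, discreteMeasure_apply _ _ hYo.measurableSet]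

end NaiveMeasure

/-! ### The covering outer measure recovers `m` on Borel sets. -/

section Caratheodory

variable {M : ℕ} {NI : Set ℝ} {m : Measure ℂ}

/-- The outer measure obtained by covering with the rectangles in `Sq*`, weighted by `m`. -/
noncomputable def coverMeasure (m : Measure ℂ) (M : ℕ) (NI : Set ℝ) : OuterMeasure ℂ :=
  OuterMeasure.boundedBy fun X : Set ℂ => ⨅ _ : X ∈ SqStar M NI, m X

theorem coverMeasure_le {Y : Set ℂ} (hY : Y ∈ SqStar M NI) : coverMeasure m M NI Y ≤ m Y :=
  (OuterMeasure.boundedBy_le _).trans (iInf_le _ hY)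

theorem le_coverMeasure (X : Set ℂ) : m X ≤ coverMeasure m M NI X :=
  (OuterMeasure.le_boundedBy (μ := m.toOuterMeasure)).2 (fun _ => le_iInf fun _ => le_rfl) X

theorem inter_gt_re_mem_SqStar {Y : Set ℂ} (hY : Y ∈ SqStar M NI) {t : ℝ} (ht : t ∈ NI) :
    Y ∩ {z | t < z.re} ∈ SqStar M NI := by
  obtain ⟨r₀, h₀, r₁, h₁, r₂, h₂, r₃, h₃, rfl⟩ := hY
  refine ⟨max r₀ t, by rcases max_choice r₀ t with h | h <;> rwa [h], r₁, h₁, r₂, h₂, r₃, h₃, ?_⟩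
  ext z
  simp only [Set.mem_inter_iff, Set.mem_ofPred_eq, max_lt_iff]
  tauto

theorem inter_lt_re_mem_SqStar {Y : Set ℂ} (hY : Y ∈ SqStar M NI) {t : ℝ} (ht : t ∈ NI) :
    Y ∩ {z | z.re < t} ∈ SqStar M NI := by
  obtain ⟨r₀, h₀, r₁, h₁, r₂, h₂, r₃, h₃, rfl⟩ := hY
  refine ⟨r₀, h₀, min r₁ t, by rcases min_choice r₁ t with h | h <;> rwa [h], r₂, h₂, r₃, h₃, ?_⟩
  ext z
  simp only [Set.mem_inter_iff, Set.mem_ofPred_eq, lt_min_iff]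
  tauto

theorem inter_gt_im_mem_SqStar {Y : Set ℂ} (hY : Y ∈ SqStar M NI) {t : ℝ} (ht : t ∈ NI) :
    Y ∩ {z | t < z.im} ∈ SqStar M NI := by
  obtain ⟨r₀, h₀, r₁, h₁, r₂, h₂, r₃, h₃, rfl⟩ := hY
  refine ⟨r₀, h₀, r₁, h₁, max r₂ t, by rcases max_choice r₂ t with h | h <;> rwa [h], r₃, h₃, ?_⟩
  ext z
  simp only [Set.mem_inter_iff, Set.mem_ofPred_eq, max_lt_iff]
  tauto

theorem inter_lt_im_mem_SqStar {Y : Set ℂ} (hY : Y ∈ SqStar M NI) {t : ℝ} (ht : t ∈ NI) :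
    Y ∩ {z | z.im < t} ∈ SqStar M NI := by
  obtain ⟨r₀, h₀, r₁, h₁, r₂, h₂, r₃, h₃, rfl⟩ := hY
  refine ⟨r₀, h₀, r₁, h₁, r₂, h₂, min r₃ t, by rcases min_choice r₃ t with h | h <;> rwa [h], ?_⟩
  ext z
  simp only [Set.mem_inter_iff, Set.mem_ofPred_eq, lt_min_iff]
  tauto

theorem exists_mem_Ioo_of_dense (hdense : Set.Icc (-(M : ℝ)) M ⊆ closure NI) {a b : ℝ}
    (ha : -(M : ℝ) ≤ a) (haM : a < M) (hab : a < b) : ∃ t ∈ NI, a < t ∧ t < b := by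
  obtain ⟨c, hc1, hc2⟩ := exists_between (lt_min hab haM)
  obtain ⟨t, ht, htN⟩ := mem_closure_iff.1
    (hdense ⟨ha.trans hc1.le, (hc2.trans_le (min_le_right _ _)).le⟩) (Set.Ioo a b) isOpen_Ioo
    ⟨hc1, hc2.trans_le (min_le_left _ _)⟩
  exact ⟨t, htN, ht⟩

variable [IsFiniteMeasure m]

/-- A half-plane `{p > t}` splits the outer measure `coverMeasure` additively. -/
theorem isCaratheodory_halfplane (hsub : NI ⊆ Set.Icc (-(M : ℝ)) M)
    (hdense : Set.Icc (-(M : ℝ)) M ⊆ closure NI) {p : ℂ → ℝ} (hp : Continuous p)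
    (hpM : ∀ z ∈ square M, p z ≤ M)
    (hgt : ∀ Y ∈ SqStar M NI, ∀ t ∈ NI, Y ∩ {z | t < p z} ∈ SqStar M NI)
    (hlt : ∀ Y ∈ SqStar M NI, ∀ t ∈ NI, Y ∩ {z | p z < t} ∈ SqStar M NI) {t : ℝ} (ht : t ∈ NI) :
    MeasurableSet[(coverMeasure m M NI).caratheodory] {z | t < p z} := by
  rw [OuterMeasure.isCaratheodory_iff_le]
  set s : Set ℂ := {z | t < p z} with hs
  have hsm : MeasurableSet s := (isOpen_lt continuous_const hp).measurableSet
  -- Splitting needs to be checked on the rectangles only, since `le_boundedBy` then extends it to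
  -- all sets.
  have key : ∀ Y ∈ SqStar M NI,
      coverMeasure m M NI (Y ∩ s) + coverMeasure m M NI (Y ∩ sᶜ) ≤ m Y := by
    intro Y hY
    have hYo : MeasurableSet Y := (isOpen_of_mem_SqStar hsub hY).measurableSet
    rw [← measure_inter_add_sdiff Y hsm]
    refine add_le_add (coverMeasure_le (hgt Y hY t ht)) ?_
    rcases (hsub ht).2.lt_or_eq with htM | htM
    -- The piece `Y ∩ {p ≤ t}` is not open; it is approximated from above by the rectangles `Y ∩ {p
    -- < q}`, with `q ∈ NI` decreasing to `t`.
    · have hlim := tendsto_measure_biInter_gt (μ := m) (s := fun t' => Y ∩ {z | p z < t'}) (a := t)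
        (fun r _ => (hYo.inter (isOpen_lt hp continuous_const).measurableSet).nullMeasurableSet)
        (fun i j _ hij => Set.inter_subset_inter_right _ fun z (hz : p z < i) => hz.trans_le hij)
        ⟨t + 1, by simp, measure_ne_top _ _⟩
      have hset : ⋂ r > t, Y ∩ {z | p z < r} = Y \ s := by
        ext z
        simp only [Set.mem_iInter, Set.mem_inter_iff, Set.mem_ofPred_eq, Set.mem_sdiff, hs, not_lt]
        exact ⟨fun h => ⟨(h (t + 1) (by simp)).1, le_of_forall_gt fun r hr => (h r hr).2⟩,
          fun h r hr => ⟨h.1, h.2.trans_lt hr⟩⟩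
      rw [hset] at hlim
      refine ge_of_tendsto hlim (eventually_nhdsWithin_of_forall fun t' ht' => ?_)
      obtain ⟨q, hq, hq1, hq2⟩ := exists_mem_Ioo_of_dense hdense (hsub ht).1 htM ht'
      calc coverMeasure m M NI (Y ∩ sᶜ) ≤ coverMeasure m M NI (Y ∩ {z | p z < q}) :=
            measure_mono (Set.inter_subset_inter_right _ fun z hz =>
              (not_lt.1 (show ¬ t < p z from hz)).trans_lt hq1)
        _ ≤ m (Y ∩ {z | p z < q}) := coverMeasure_le (hlt Y hY q hq)
        _ ≤ m (Y ∩ {z | p z < t'}) :=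
            measure_mono (Set.inter_subset_inter_right _ fun z (hz : p z < q) => hz.trans hq2)
    -- At `t = M` there is no `q ∈ NI` above `t`, but `p ≤ M` on `S` makes the upper piece empty.
    · have hYs : Y \ s = Y := by
        obtain ⟨r₀, h₀, r₁, h₁, r₂, h₂, r₃, h₃, rfl⟩ := hY
        refine sdiff_eq_left.2 (Set.disjoint_left.2 fun z hz hzs => ?_)
        exact absurd (hpM z hz.1) (not_le.2 (htM ▸ hzs))
      rw [hYs]
      exact (measure_mono Set.inter_subset_left).trans (coverMeasure_le hY)
  have hle : OuterMeasure.restrict s (coverMeasure m M NI) +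
      OuterMeasure.restrict sᶜ (coverMeasure m M NI) ≤ coverMeasure m M NI := by
    conv_rhs => rw [coverMeasure]
    rw [OuterMeasure.le_boundedBy]
    intro X
    refine le_iInf fun hX => ?_
    simpa using key X hX
  intro X
  simpa [Set.sdiff_eq] using hle X

theorem borel_le_caratheodory (hsub : NI ⊆ Set.Icc (-(M : ℝ)) M)
    (hcount : NI.Countable) (hdense : Set.Icc (-(M : ℝ)) M ⊆ closure NI)
    (B : Set ℂ) (hB : MeasurableSet B) :
    MeasurableSet[(OuterMeasure.restrict (openSquare M) (coverMeasure m M NI)).caratheodory] B := by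
  set ν := coverMeasure m M NI with hν
  have hres : ∀ s, MeasurableSet[ν.caratheodory] s →
      MeasurableSet[(OuterMeasure.restrict (openSquare M) ν).caratheodory] s := by
    intro s hs
    rw [OuterMeasure.isCaratheodory_iff] at hs ⊢
    intro X
    simp only [OuterMeasure.restrict_apply]
    rw [hs (X ∩ openSquare M)]
    congr 2
    · ext z; simp; tauto
    · ext z; simp; tauto
  have hgen : ∀ p : ℂ → ℝ, Continuous p → (∀ z ∈ openSquare M, -(M : ℝ) < p z) →
      (∀ z ∈ square M, p z ≤ M) → (∀ z ∈ openSquare M, p z < M) →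
      (∀ Y ∈ SqStar M NI, ∀ t ∈ NI, Y ∩ {z | t < p z} ∈ SqStar M NI) →
      (∀ Y ∈ SqStar M NI, ∀ t ∈ NI, Y ∩ {z | p z < t} ∈ SqStar M NI) →
      Measurable[(OuterMeasure.restrict (openSquare M) ν).caratheodory] p := by
    intro p hp hp1 hp2 hp3 hgt hlt
    refine measurable_of_Ioi fun t => ?_
    -- Measurability depends only on the trace on `S⁻`; levels `t` outside `[-M, M)` give the trace
    -- `∅` or all of `S⁻`.
    have hcongr : ∀ s s' : Set ℂ, s ∩ openSquare M = s' ∩ openSquare M →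
        MeasurableSet[(OuterMeasure.restrict (openSquare M) ν).caratheodory] s' →
        MeasurableSet[(OuterMeasure.restrict (openSquare M) ν).caratheodory] s := by
      intro s s' hss h
      rw [OuterMeasure.isCaratheodory_iff] at h ⊢
      intro X
      have := h X
      simp only [OuterMeasure.restrict_apply] at this ⊢
      rw [this]
      have hz : ∀ z ∈ openSquare M, z ∈ s ↔ z ∈ s' := fun z hz =>
        ⟨fun h => (hss.subset ⟨h, hz⟩).1, fun h => (hss.superset ⟨h, hz⟩).1⟩
      congr 2
      · ext z
        have := hz z
        simp only [Set.mem_inter_iff]; tauto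
      · ext z
        have := hz z
        simp only [Set.mem_inter_iff, Set.mem_sdiff]; tauto
    rcases le_or_gt (M : ℝ) t with htM | htM
    · refine hcongr _ ∅ ?_ (@MeasurableSet.empty ℂ (OuterMeasure.restrict (openSquare M) ν).caratheodory)
      ext z
      simp only [Set.mem_inter_iff, Set.mem_preimage, Set.mem_Ioi, Set.empty_inter,
        Set.mem_empty_iff_false, iff_false, not_and]
      exact fun h hz => absurd (hp3 z hz) (not_lt.2 (htM.trans h.le))
    rcases lt_or_ge t (-(M : ℝ)) with htM' | htM'
    · refine hcongr _ Set.univ ?_ (@MeasurableSet.univ ℂ (OuterMeasure.restrict (openSquare M) ν).caratheodory)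
      ext z
      simp only [Set.mem_inter_iff, Set.mem_preimage, Set.mem_Ioi, Set.mem_univ, true_and,
        and_iff_right_iff_imp]
      exact fun hz => htM'.trans (hp1 z hz)
    have hU : p ⁻¹' Set.Ioi t = ⋃ q ∈ NI ∩ Set.Ioi t, {z | q < p z} := by
      ext z
      simp only [Set.mem_preimage, Set.mem_Ioi, Set.mem_iUnion, Set.mem_inter_iff,
        Set.mem_ofPred_eq, exists_prop]
      constructor
      · intro h
        obtain ⟨q, hq, h1, h2⟩ := exists_mem_Ioo_of_dense hdense htM' htM h
        exact ⟨q, ⟨hq, h1⟩, h2⟩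
      · rintro ⟨q, ⟨-, h1⟩, h2⟩
        exact h1.trans h2
    rw [hU]
    exact MeasurableSet.biUnion (hcount.mono Set.inter_subset_left) fun q hq =>
      hres _ (isCaratheodory_halfplane hsub hdense hp hp2 hgt hlt hq.1)
  have hre := hgen Complex.re Complex.continuous_re (fun z h => h.1) (fun z h => h.2.1)
    (fun z h => h.2.1) (fun _ hY _ ht => inter_gt_re_mem_SqStar hY ht)
    (fun _ hY _ ht => inter_lt_re_mem_SqStar hY ht)
  have him := hgen Complex.im Complex.continuous_im (fun z h => h.2.2.1) (fun z h => h.2.2.2)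
    (fun z h => h.2.2.2) (fun _ hY _ ht => inter_gt_im_mem_SqStar hY ht)
    (fun _ hY _ ht => inter_lt_im_mem_SqStar hY ht)
  -- Measurability of the identity into the Borel σ-algebra says precisely that Borel sets are
  -- Carathéodory measurable.
  have hid : Measurable[(OuterMeasure.restrict (openSquare M) ν).caratheodory] (id : ℂ → ℂ) :=
    @Complex.measurableEquivRealProd.symm.measurable.comp _ _ _ _ _ _ _ _ (hre.prodMk him)
  exact hid hB

/-- On Borel sets the covering outer measure restricted to the open square agrees with `m`. -/
theorem coverMeasure_eq (hsub : NI ⊆ Set.Icc (-(M : ℝ)) M)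
    (hcount : NI.Countable) (hdense : Set.Icc (-(M : ℝ)) M ⊆ closure NI)
    (hleft : -(M : ℝ) ∈ NI) (hright : (M : ℝ) ∈ NI) (hS : m (openSquare M)ᶜ = 0)
    {B : Set ℂ} (hB : MeasurableSet B) :
    OuterMeasure.restrict (openSquare M) (coverMeasure m M NI) B = m B := by
  -- Since `±M ∈ NI`, the set `S⁻` is a single rectangle, so the total covering mass is at most that
  -- of `m`.
  have hmem : openSquare M ∈ SqStar M NI := by
    refine ⟨_, hleft, _, hright, _, hleft, _, hright, Set.ext fun z => ⟨fun h => ⟨?_, h⟩, fun h => h.2⟩⟩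
    exact openSquare_subset_square M h
  have hSm := (isOpen_openSquare M).measurableSet
  have hms : ∀ X, m (X ∩ openSquare M) = m X := fun X =>
    measure_inter_conull hS
  have hge : ∀ X, m X ≤ OuterMeasure.restrict (openSquare M) (coverMeasure m M NI) X := by
    intro X
    rw [OuterMeasure.restrict_apply, ← hms X]
    exact le_coverMeasure _
  refine le_antisymm ?_ (hge B)
  -- The masses of `B` and `Bᶜ` each dominate `m` and add up to at most the finite total mass of
  -- `m`, so both are equalities.
  have h1 := OuterMeasure.isCaratheodory_iff _ |>.1
    (borel_le_caratheodory (m := m) hsub hcount hdense B hB) Set.univ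
  have h2 : OuterMeasure.restrict (openSquare M) (coverMeasure m M NI) Set.univ ≤ m Set.univ := by
    rw [OuterMeasure.restrict_apply, Set.univ_inter]
    exact (coverMeasure_le hmem).trans (measure_mono (Set.subset_univ _))
  rw [h1, Set.univ_inter, ← measure_add_measure_compl hB, ← Set.compl_eq_univ_sdiff] at h2
  have h3 := (add_le_add_right (hge Bᶜ) _).trans h2
  exact (ENNReal.add_le_add_iff_right (measure_ne_top m _)).1 h3

end Caratheodory

/-! ### Assembly of the theorem. -/

theorem ultrafilter_le_atTop (D : Ultrafilter ℕ)
    (hD : ∀ m : ℕ, m ≠ 0 → {N : ℕ | N ≠ 0 ∧ ∃ k : ℕ, N = k ^ 2 ∧ m ∣ k} ∈ D) :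
    (D : Filter ℕ) ≤ atTop := by
  refine le_iInf fun n => le_principal_iff.2 (mem_of_superset (hD (n + 1) (Nat.succ_ne_zero n)) ?_)
  rintro N ⟨hN, k, rfl, hk⟩
  have hk0 : k ≠ 0 := fun h => hN (by simp [h])
  have h1 := Nat.le_of_dvd (Nat.pos_of_ne_zero hk0) hk
  have h2 : k ≤ k ^ 2 := Nat.le_self_pow two_ne_zero k
  exact (Nat.le_succ n).trans (h1.trans h2)

theorem muStar_eq_restrict_coverMeasure {D : Ultrafilter ℕ} {d : ℕ → ℕ}
    {lam : ∀ N, Fin (d N) → ℂ} {xi : ∀ N, Fin (d N) → ℝ} {M : ℕ} {NI : Set ℝ} {m : Measure ℂ}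
    (h : ∀ Y ∈ SqStar M NI, ENNReal.ofReal (muNaive D lam xi Y) = m Y) :
    muStar D lam xi M NI = OuterMeasure.restrict (openSquare M) (coverMeasure m M NI) := by
  have : (fun X : Set ℂ => ⨅ _ : X ∈ SqStar M NI, ENNReal.ofReal (muNaive D lam xi X)) =
      fun X => ⨅ _ : X ∈ SqStar M NI, m X :=
    funext fun X => iInf_congr fun hX => h X hX
  rw [muStar, coverMeasure, this]

end UltraSpectral

theorem lemma2p5 {H : Type*} [NormedAddCommGroup H] [InnerProductSpace ℂ H] [CompleteSpace H]
    [TopologicalSpace.SeparableSpace H]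
    -- the operator `A = q U` with `U` unitary, so that `A* A = A A* = |q|² I`
    (A U : H →L[ℂ] H) (q : ℂ) (hq : q ≠ 0) (hU : U ∈ unitary (H →L[ℂ] H)) (hA : A = q • U)
    -- the cyclic unit vector
    (φ : H) (hφ : ‖φ‖ = 1) (hcyc : UltraSpectral.IsCyclicVector A φ)
    -- the unitaries used to build the operators `A_N`
    (V : ∀ N, UltraSpectral.Wminus A φ N ≃ₗᵢ[ℂ] UltraSpectral.Wplus A φ N)
    -- orthonormal eigenbases of the `A_N`, with `⟨u_N(n) | φ⟩ = ξ_N(n) ≥ 0`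
    (u : ∀ N, OrthonormalBasis (Fin (Module.finrank ℂ (UltraSpectral.HN A φ N))) ℂ
      (UltraSpectral.HN A φ N))
    (lam : ∀ N, Fin (Module.finrank ℂ (UltraSpectral.HN A φ N)) → ℂ)
    (hlam : ∀ N n, UltraSpectral.AN A φ (‖q‖ ^ 2) N (V N) (u N n) = lam N n • u N n)
    (xi : ∀ N, Fin (Module.finrank ℂ (UltraSpectral.HN A φ N)) → ℝ)
    (hxi : ∀ N n, inner ℂ ((u N n : UltraSpectral.HN A φ N) : H) φ = (xi N n : ℂ))
    (hxi_nonneg : ∀ N n, 0 ≤ xi N n)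
    -- the size of the square `S`
    (M : ℕ) (hMA : ‖A‖ < M) (hMq : √(‖q‖ ^ 2) < M)
    -- the ultrafilter
    (D : Ultrafilter ℕ)
    (hD : ∀ m : ℕ, m ≠ 0 → {N : ℕ | N ≠ 0 ∧ ∃ k : ℕ, N = k ^ 2 ∧ m ∣ k} ∈ D)
    -- the countable dense set of nice reals
    (NI : Set ℝ) (hNI_count : NI.Countable) (hNI_sub : NI ⊆ Set.Icc (-(M : ℝ)) M)
    (hNI_dense : Set.Icc (-(M : ℝ)) M ⊆ closure NI)
    (hNI_nice : ∀ t ∈ NI, UltraSpectral.IsNice D lam xi M t)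
    (hNI_left : -(M : ℝ) ∈ NI) (hNI_right : (M : ℝ) ∈ NI) :
    spectrum ℂ A = UltraSpectral.sigmaStar D lam xi M NI ∧
    (MeasurableSet[(UltraSpectral.muStar D lam xi M NI).caratheodory] (spectrum ℂ A) ∧
      UltraSpectral.mu D lam xi M NI (spectrum ℂ A) = 1) ∧
    (MeasurableSet[(UltraSpectral.muStar D lam xi M NI).caratheodory]
        (UltraSpectral.square M \ spectrum ℂ A) ∧
      UltraSpectral.mu D lam xi M NI (UltraSpectral.square M \ spectrum ℂ A) = 0) := by
  open UltraSpectral in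
  have hnormal : IsStarNormal A := by
    rw [hA]
    constructor
    rw [star_smul]
    refine Commute.smul_left (Commute.smul_right ?_ _) _
    rw [commute_iff_eq, Unitary.star_mul_self_of_mem hU, Unitary.mul_star_self_of_mem hU]
  have : Nontrivial H := ⟨φ, 0, by rintro rfl; simp at hφ⟩
  obtain ⟨m, hprob, hmom, hsupp, hpos⟩ := exists_spectral_measure A hnormal φ hφ hcyc
  have hball : spectrum ℂ A ⊆ Metric.closedBall 0 ‖A‖ := fun z hz => by
    simpa using spectrum.norm_le_norm_of_mem hz
  have hsq : spectrum ℂ A ⊆ openSquare M := fun z hz => by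
    have h : ‖z‖ < M := (spectrum.norm_le_norm_of_mem hz).trans_lt hMA
    have h1 := abs_lt.1 ((Complex.abs_re_le_norm z).trans_lt h)
    have h2 := abs_lt.1 ((Complex.abs_im_le_norm z).trans_lt h)
    exact ⟨h1.1, h1.2, h2.1, h2.2⟩
  have hS : m (openSquare M)ᶜ = 0 := measure_mono_null (Set.compl_subset_compl.2 hsq) hsupp
  let P : ProbabilityMeasure ℂ := ⟨m, hprob⟩
  let μ : ℕ → ProbabilityMeasure ℂ := fun N =>
    ⟨discreteMeasure (lam N) (xi N), isProbabilityMeasure_discreteMeasure hφ (hxi N)⟩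
  have hlim : Tendsto μ D (𝓝 P) := by
    refine tendsto_of_eventually_moments (R := ‖A‖ + √(‖q‖ ^ 2))
      (fun N => discreteMeasure_compl_closedBall (hlam N)) ?_ fun i j => ?_
    · refine measure_mono_null (Set.compl_subset_compl.2 (hball.trans ?_)) hsupp
      exact Metric.closedBall_subset_closedBall (by simp)
    · filter_upwards [ultrafilter_le_atTop D hD (eventually_ge_atTop (max i j))] with N hN
      exact (moment_discreteMeasure (hlam N) (hxi N) ((le_max_left i j).trans hN)
        ((le_max_right i j).trans hN)).trans (hmom i j).symm
  have hstar := muStar_eq_restrict_coverMeasure (m := m) fun Y hY =>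
    muNaive_eq_of_mem_SqStar (μ := μ) (m := P) (fun _ => rfl) hlim hS hNI_sub hNI_nice hY
  have hcar : ∀ B, MeasurableSet B →
      MeasurableSet[(muStar D lam xi M NI).caratheodory] B := fun B hB => by
    rw [hstar]
    exact borel_le_caratheodory hNI_sub hNI_count hNI_dense B hB
  have hmu : ∀ B, MeasurableSet B → mu D lam xi M NI B = m B := fun B hB => by
    rw [mu, @toMeasure_apply _ (muStar D lam xi M NI).caratheodory _ _ _ (hcar B hB), hstar]
    exact coverMeasure_eq hNI_sub hNI_count hNI_dense hNI_left hNI_right hS hB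
  have hspec : MeasurableSet (spectrum ℂ A) := (spectrum.isClosed A).measurableSet
  have hsquare : MeasurableSet (square M) := by
    refine IsClosed.measurableSet ?_
    simp only [square, Set.ofPred_and]
    refine (isClosed_le ?_ ?_).inter ((isClosed_le ?_ ?_).inter ((isClosed_le ?_ ?_).inter
      (isClosed_le ?_ ?_))) <;> fun_prop
  refine ⟨Set.Subset.antisymm ?_ ?_, ⟨hcar _ hspec, ?_⟩, hcar _ (MeasurableSet.diff hsquare hspec), ?_⟩
  · intro z hz
    refine ⟨hsq hz, fun W hW hzW _ => ?_⟩
    rw [hmu W hW.measurableSet]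
    exact hpos z hz W hW hzW
  · rintro z ⟨hzS, hz⟩
    by_contra hzA
    -- Off the spectrum, `S⁻ \ σ(A)` is itself an open `m`-null neighbourhood of `z`.
    have h := hz (openSquare M ∩ (spectrum ℂ A)ᶜ)
      ((isOpen_openSquare M).inter (spectrum.isClosed A).isOpen_compl) ⟨hzS, hzA⟩
      Set.inter_subset_left
    rw [hmu _ ((isOpen_openSquare M).measurableSet.inter hspec.compl)] at h
    exact h.ne' (measure_mono_null Set.inter_subset_right hsupp)
  · rw [hmu _ hspec]
    exact (prob_compl_eq_zero_iff hspec).1 hsupp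
  · rw [hmu _ (MeasurableSet.diff hsquare hspec)]
    exact measure_mono_null (fun z hz => hz.2) hsupp
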